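/- Theorem 2. Let $d\ge 0$ and $T>d$ be integers, let $\mathcal A\subset\mathbb R^d$ be a finite action class, and let each arm $s\in[d]=\{1,\dots,d\}$ have an $R$-sub-Gaussian reward distribution $\phi_s$ ($R>0$, i.e. $\mathbb E[e^{\lambda (X-\mu_s)}]\le e^{R^2\lambda^2/2}$ for $X\sim\phi_s$ and all $\lambda\in\mathbb R$) with mean $\mu_s$. Assume that $\boldsymbol\mu^\top\boldsymbol\pi$ has a unique maximizer $\boldsymbol\pi^*$ over $\boldsymbol\pi\in\mathcal A$. The successive rewards of each arm are independent draws from its distribution. Put $$\Delta_s=\min_{\boldsymbol\pi\in\mathcal A,\ \pi_s\ne\pi^*_s}\frac{\boldsymbol\mu^\top(\boldsymbol\pi^*-\boldsymbol\pi)}{|\pi^*_s-\pi_s|}\quad(\Delta_s=\infty\text{ if there is no such }\boldsymbol\pi),\qquad \mathbf H_2=\max_{s\in[d]}\frac{s}{\Delta_{(s)}^2},$$ where $\Delta_{(1)}\le\dots\le\Delta_{(d)}$ are the $\Delta_s$ in increasing order, and $$L=\max_{\substack{e\in[d],\ \boldsymbol\pi^1,\boldsymbol\pi^2,\boldsymbol\pi^3\in\mathcal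 A\\ \pi^1_e\ne\pi^3_e}}\frac{|\pi^1_e-\pi^2_e|}{|\pi^1_e-\pi^3_e|},\qquad U_{\mathcal A}=\max_{\substack{\boldsymbol\pi,\boldsymbol\pi'\in\mathcal A,\ e\in[d]\\ \pi_e\ne\pi'_e}}\frac{\sum_{s=1}^d|\pi_s-\pi'_s|}{|\pi_e-\pi'_e|},\qquad \widetilde{\log}(d)=\sum_{s=1}^d\frac1s .$$ For a finite set $S\subset[d]\times\mathbb R$ let $\mathcal A_S=\{\boldsymbol\pi\in\mathcal A:\pi_e=x\ \forall (e,x)\in S\}$, and let $\mathrm{COracle}(\boldsymbol\nu,S)$ return some maximizer of $\boldsymbol\nu^\top\boldsymbol\pi$ over $\mathcal A_S$, or the null symbol $\perp$ if $\mathcal A_S=\emptyset$; the value $\boldsymbol\nu^\top\!\perp$ is read as $-\infty$. The CSA (Combinatorial Successive Assign) algorithm with budget $T$ starts with $F(1)=S(1)=\emptyset$, $\tilde T(0)=0$, and in each phase $t=1,\dots,d$: 1. pulls each arm $e\in[d]\setminus F(t)$ exactly $\tilde T(t)-\tilde T(t-1)$ times, where $\tilde T(t)=\big\lceil \frac{T-d}{\widetilde{\log}(d)\,(d-t+1)}\big\rceil$,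 and lets $\hat{\boldsymbol\mu}(t)$ be the vector of empirical means of all rewards so far; 2. sets $\hat{\boldsymbol\pi}(t)=\mathrm{COracle}(\hat{\boldsymbol\mu}(t),S(t))$, and stops with output $\boldsymbol\pi^{\mathrm{out}}=\perp$ if this is $\perp$; 3. for each $e\in[d]\setminus F(t)$, lets $\tilde{\boldsymbol\pi}^e(t)$ be an answer of largest value $\hat{\boldsymbol\mu}(t)^\top\boldsymbol\pi$ among $\mathrm{COracle}(\hat{\boldsymbol\mu}(t),S(t)\cup\{(e,x)\})$, where $x$ runs over the values $\ne\hat\pi_e(t)$ of the $e$-th element of actions in $\mathcal A$ ($\tilde{\boldsymbol\pi}^e(t)=\perp$ if there is no such $x$); 4. chooses $p(t)\in[d]\setminus F(t)$ maximizing $\dfrac{\langle\hat{\boldsymbol\mu}(t),\hat{\boldsymbol\pi}(t)-\tilde{\boldsymbol\pi}^e(t)\rangle}{|\hat\pi_e(t)-\tilde\pi^e_e(t)|}$ (read as $+\infty$ if $\tilde{\boldsymbol\pi}^e(t)=\perp$), and sets $F(t+1)=F(t)\cup\{p(t)\}$, $S(t+1)=S(t)\cup\{(p(t),\hat\pi_{p(t)}(t))\}$.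 After phase $d$ it outputs the vector $\boldsymbol\pi^{\mathrm{out}}$ with $\pi^{\mathrm{out}}_e=x$ for all $(e,x)\in S(d+1)$. Then, whatever maximizers the oracle returns and however ties are broken, the CSA algorithm uses at most $T$ samples, outputs $\boldsymbol\pi^{\mathrm{out}}\in\mathcal A\cup\{\perp\}$, and satisfies $$\Pr\left[\boldsymbol\pi^{\mathrm{out}}\ne\boldsymbol\pi^*\right]\le d^2\exp\left(-\frac{T-d}{2(2+L^2)^2R^2\,\widetilde{\log}(d)\,U_{\mathcal A}^2\,\mathbf H_2}\right).$$ (If $\mathcal A$ has only one element or $d=0$, the maxima defining $L$, $U_{\mathcal A}$ are over empty sets and the quotient in the exponent is read as $0$.) -/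

import Mathlib

open MeasureTheory ProbabilityTheory
open scoped NNReal ENNReal

noncomputable section

namespace CSA

/-- `π` is the (unique) best action: the maximizer of `μᵀπ` over the action class `A`. -/
def IsBestAction {d : ℕ} (A : Finset (Fin d → ℝ)) (μ π : Fin d → ℝ) : Prop :=
  π ∈ A ∧ ∀ π' ∈ A, π' ≠ π → μ ⬝ᵥ π' < μ ⬝ᵥ π

/-! ### The complexity measures -/

/-- The G-gap `Δ_s`, the minimum of `μᵀ(π* - π) / |π*_s - π_s|` over the actions `π` whose `s`-th
element differs from that of `π*`. It is `∞` if there is no such action. -/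
def gap {d : ℕ} (A : Finset (Fin d → ℝ)) (μ πstar : Fin d → ℝ) (s : Fin d) : ℝ≥0∞ :=
  ⨅ π ∈ A, ⨅ _ : π s ≠ πstar s, ENNReal.ofReal (μ ⬝ᵥ (πstar - π) / |πstar s - π s|)

/-- The gaps in increasing order: `sortedGap A μ π* s` is `Δ_(s + 1)` (indices start at `0`). -/
def sortedGap {d : ℕ} (A : Finset (Fin d → ℝ)) (μ πstar : Fin d → ℝ) (s : Fin d) : ℝ≥0∞ :=
  gap A μ πstar (Tuple.sort (gap A μ πstar) s)

/-- `H₂ = max_s s / Δ_(s)²`. -/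
def H2 {d : ℕ} (A : Finset (Fin d → ℝ)) (μ πstar : Fin d → ℝ) : ℝ≥0∞ :=
  ⨆ s : Fin d, (((s : ℕ) + 1 : ℕ) : ℝ≥0∞) / sortedGap A μ πstar s ^ 2

/-- `L`, the maximum of `|π¹_e - π²_e| / |π¹_e - π³_e|` over `e` and over actions with
`π¹_e ≠ π³_e`. -/
def L {d : ℕ} (A : Finset (Fin d → ℝ)) : ℝ :=
  sSup {r : ℝ | ∃ e : Fin d, ∃ π₁ ∈ A, ∃ π₂ ∈ A, ∃ π₃ ∈ A,
    π₁ e ≠ π₃ e ∧ r = |π₁ e - π₂ e| / |π₁ e - π₃ e|}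

/-- `U_A`, the maximum of `(∑ s, |π_s - π'_s|) / |π_e - π'_e|` over actions and `e` with
`π_e ≠ π'_e`. -/
def U {d : ℕ} (A : Finset (Fin d → ℝ)) : ℝ :=
  sSup {r : ℝ | ∃ π ∈ A, ∃ π' ∈ A, ∃ e : Fin d,
    π e ≠ π' e ∧ r = (∑ s, |π s - π' s|) / |π e - π' e|}

/-! ### Oracles and tie-breaking -/

/-- `A_S`: the actions `π` with `π_e = x` for all `(e, x) ∈ S`. -/
def feasible {d : ℕ} (A : Finset (Fin d → ℝ)) (S : Finset (Fin d × ℝ)) : Set (Fin d → ℝ) :=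
  {π | π ∈ A ∧ ∀ q ∈ S, π q.1 = q.2}

/-- A constrained offline oracle: it returns some maximizer of `νᵀπ` over `A_S` if `A_S` is not
empty, and the null symbol (`none`) otherwise. -/
structure COracle {d : ℕ} (A : Finset (Fin d → ℝ)) where
  /-- the answer of the oracle -/
  ask : (Fin d → ℝ) → Finset (Fin d × ℝ) → Option (Fin d → ℝ)
  ask_of_nonempty : ∀ ν S, (feasible A S).Nonempty →
    ∃ π ∈ feasible A S, ask ν S = some π ∧ ∀ π' ∈ feasible A S, ν ⬝ᵥ π' ≤ ν ⬝ᵥ π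
  ask_of_empty : ∀ ν S, feasible A S = ∅ → ask ν S = none

/-- A rule that selects, from a nonempty finite set, a maximizer of a given function
(ties may be broken in any way). -/
structure ArgmaxRule (α : Type) where
  /-- the selected element -/
  sel : (s : Finset α) → s.Nonempty → (α → EReal) → α
  sel_mem : ∀ (s : Finset α) (hs : s.Nonempty) (f : α → EReal), sel s hs f ∈ s
  le_sel : ∀ (s : Finset α) (hs : s.Nonempty) (f : α → EReal), ∀ a ∈ s, f a ≤ f (sel s hs f)

/-- The value `νᵀπ` of an oracle answer; the null symbol has value `-∞`. -/
def value {d : ℕ} (ν : Fin d → ℝ) : Option (Fin d → ℝ) → EReal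
  | none => ⊥
  | some π => ((ν ⬝ᵥ π : ℝ) : EReal)

/-! ### The algorithm -/

/-- `POSSIBLE-PI(e)`: the values that an action can take as its `e`-th element. -/
def possiblePi {d : ℕ} (A : Finset (Fin d → ℝ)) (e : Fin d) : Finset ℝ :=
  A.image fun π => π e

/-- `T̃(t) = ⌈(T - d) / (log~(d) (d - t + 1))⌉` for `t ≥ 1`, and `T̃(0) = 0`. -/
def phaseBudget (d T t : ℕ) : ℕ :=
  if t = 0 then 0
  else ⌈((T : ℝ) - d) / ((harmonic d : ℝ) * ((d : ℝ) - t + 1))⌉₊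

/-- The state of the algorithm between two phases. -/
structure State (d : ℕ) where
  /-- `F(t)`, the arms that have been assigned a value -/
  F : Finset (Fin d)
  /-- `S(t)`, the pairs of an arm and its assigned value -/
  S : Finset (Fin d × ℝ)
  /-- the number of times each arm has been pulled so far -/
  N : Fin d → ℕ
  /-- whether the algorithm has stopped with the null symbol as its output -/
  failed : Bool

/-- The initial state. -/
def State.init (d : ℕ) : State d where
  F := ∅
  S := ∅
  N := fun _ => 0
  failed := false

/-- The empirical means when arm `e` has been pulled `N e` times; `x e i` is the reward of the
`(i + 1)`-st pull of arm `e`. -/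
def empMean {d : ℕ} (x : Fin d → ℕ → ℝ) (N : Fin d → ℕ) (e : Fin d) : ℝ :=
  (∑ i ∈ Finset.range (N e), x e i) / N e

/-- The numbers of pulls after each arm outside `F` has been pulled `T̃(t) - T̃(t - 1)` times
in phase `t`. -/
def pullActive {d : ℕ} (T t : ℕ) (F : Finset (Fin d)) (N : Fin d → ℕ) (e : Fin d) : ℕ :=
  if e ∈ F then N e else N e + (phaseBudget d T t - phaseBudget d T (t - 1))

open Classical in
/-- The challenger `π̃^e`: among the oracle answers for `S ∪ {(e, x)}`, where
`x ∈ POSSIBLE-PI(e) \ {π̂_e}`, one with the largest value; the null symbol if there is no such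
`x`. -/
def challenger {d : ℕ} {A : Finset (Fin d → ℝ)} (O : COracle A) (ruleX : ArgmaxRule ℝ)
    (ν : Fin d → ℝ) (S : Finset (Fin d × ℝ)) (πhat : Fin d → ℝ) (e : Fin d) :
    Option (Fin d → ℝ) :=
  if h : ((possiblePi A e).erase (πhat e)).Nonempty then
    O.ask ν (insert (e, ruleX.sel _ h fun x => value ν (O.ask ν (insert (e, x) S))) S)
  else none

/-- The empirical gap `⟨ν, π̂ - π̃^e⟩ / |π̂_e - π̃^e_e|` of arm `e`; it is `+∞` if the challenger
is the null symbol (whose value is `-∞`). -/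
def empGap {d : ℕ} (ν πhat : Fin d → ℝ) (e : Fin d) : Option (Fin d → ℝ) → EReal
  | none => ⊤
  | some π => ((ν ⬝ᵥ (πhat - π) / |πhat e - π e| : ℝ) : EReal)

open Classical in
/-- Phase `t` of the algorithm (`1 ≤ t ≤ d`). -/
def phase {d : ℕ} {A : Finset (Fin d → ℝ)} (O : COracle A) (ruleX : ArgmaxRule ℝ)
    (ruleP : ArgmaxRule (Fin d)) (T : ℕ) (x : Fin d → ℕ → ℝ) (t : ℕ) (σ : State d) : State d :=
  if σ.failed then σ
  else
    let N := pullActive T t σ.F σ.N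
    let ν := empMean x N
    match O.ask ν σ.S with
    | none => { σ with N := N, failed := true }
    | some πhat =>
      if h : (Finset.univ \ σ.F).Nonempty then
        let p := ruleP.sel _ h fun e => empGap ν πhat e (challenger O ruleX ν σ.S πhat e)
        { F := insert p σ.F
          S := insert (p, πhat p) σ.S
          N := N
          failed := false }
      else { σ with N := N }

/-- The state after the phases `1, …, t`. -/
def stateAfter {d : ℕ} {A : Finset (Fin d → ℝ)} (O : COracle A) (ruleX : ArgmaxRule ℝ)
    (ruleP : ArgmaxRule (Fin d)) (T : ℕ) (x : Fin d → ℕ → ℝ) : ℕ → State d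
  | 0 => State.init d
  | t + 1 => phase O ruleX ruleP T x (t + 1) (stateAfter O ruleX ruleP T x t)

open Classical in
/-- The vector whose `e`-th element is `x` for `(e, x) ∈ S`. -/
def toVector {d : ℕ} (S : Finset (Fin d × ℝ)) (e : Fin d) : ℝ :=
  if h : ∃ x, (e, x) ∈ S then h.choose else 0

/-- The output `π^out` of the algorithm with budget `T` on the table `x` of rewards. -/
def output {d : ℕ} {A : Finset (Fin d → ℝ)} (O : COracle A) (ruleX : ArgmaxRule ℝ)
    (ruleP : ArgmaxRule (Fin d)) (T : ℕ) (x : Fin d → ℕ → ℝ) : Option (Fin d → ℝ) :=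
  if (stateAfter O ruleX ruleP T x d).failed then none
  else some (toVector (stateAfter O ruleX ruleP T x d).S)

/-- The total number of samples that the algorithm uses. -/
def samples {d : ℕ} {A : Finset (Fin d → ℝ)} (O : COracle A) (ruleX : ArgmaxRule ℝ)
    (ruleP : ArgmaxRule (Fin d)) (T : ℕ) (x : Fin d → ℕ → ℝ) : ℕ :=
  ∑ e, (stateAfter O ruleX ruleP T x d).N e

end CSA

end

open MeasureTheory ProbabilityTheory
open scoped NNReal ENNReal

namespace CSA

variable {d : ℕ}

/-! ### Phase budgets -/

/-! A phase assigns a correct value as soon as its empirical means are accurate, so the error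
probability is a union bound over phases and arms. When `t` arms have been assigned, all correctly,
some unassigned arm `j` has gap at least Δ = Δ_(d-t) (`exists_sortedGap_le_gap`). Suppose every
unassigned mean is within Δ/((1+L)U) of the truth. A wrongly assigned arm would have empirical gap
below ΔL/(1+L), because π* competes with its challenger. Arm `j` would lie above this threshold if
π̂ is right at `j`; if π̂ is wrong at `j`, it would lose to π* empirically. Both are absurd
(`selected_value_eq`).

All unassigned arms have been pulled T̃ times, so accuracy concerns means of fixed prefixes of the
reward table. Sub-Gaussian concentration therefore applies despite the adaptivity of the run, and
`H2` bounds T̃·Δ² from below uniformly in the phase (`le_phaseBudget_mul`).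

The union bound carries a factor 2 for two-sided deviations. It is absorbed because 1 + L ≤ (2/3)(2
+ L²) for L ≥ 1 makes the exponent 9/4 times the required one (`le_mul_exp_of_le_one`, for d ≥ 2).
For d = 1 a one-sided deviation suffices. -/

theorem harmonic_cast_pos (hd : 0 < d) : (0 : ℝ) < (harmonic d : ℝ) := by
  exact_mod_cast harmonic_pos hd.ne'

theorem phaseBudget_succ (d T t : ℕ) :
    phaseBudget d T (t + 1) = ⌈((T : ℝ) - d) / ((harmonic d : ℝ) * ((d : ℝ) - t))⌉₊ := by
  rw [phaseBudget, if_neg t.succ_ne_zero]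
  congr 3
  push_cast
  ring

theorem phaseBudget_le_succ {T t : ℕ} (hT : d < T) (ht : t < d) :
    phaseBudget d T t ≤ phaseBudget d T (t + 1) := by
  cases t with
  | zero => simp [phaseBudget]
  | succ t =>
    rw [phaseBudget_succ, phaseBudget_succ]
    have hH := harmonic_cast_pos (d := d) (by omega)
    have h1 : ((t + 1 : ℕ) : ℝ) < d := by exact_mod_cast ht
    have h2 : (d : ℝ) < T := by exact_mod_cast hT
    push_cast at h1 ⊢
    apply Nat.ceil_mono
    apply div_le_div_of_nonneg_left (by linarith) (mul_pos hH (by linarith))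
    exact mul_le_mul_of_nonneg_left (by linarith) hH.le

theorem sum_inv_sub_eq_harmonic (d : ℕ) :
    ∑ t ∈ Finset.range d, ((d : ℝ) - t)⁻¹ = (harmonic d : ℝ) := by
  rw [← Finset.sum_range_reflect]
  simp only [harmonic]
  push_cast
  refine Finset.sum_congr rfl fun t ht => ?_
  have : t < d := Finset.mem_range.1 ht
  rw [Nat.sub_sub, Nat.cast_sub (by omega)]
  congr 1
  push_cast
  ring

/-- Each ceiling costs at most 1, which uses up the `d` samples held back from `T`; the main terms
add up to exactly `T - d`. -/
theorem sum_phaseBudget_le {T : ℕ} (hT : d < T) :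
    ∑ t ∈ Finset.range d, phaseBudget d T (t + 1) ≤ T := by
  rcases Nat.eq_zero_or_pos d with rfl | hd
  · simp
  have hH := harmonic_cast_pos hd
  have hTd : (d : ℝ) < T := by exact_mod_cast hT
  have key : ∀ t ∈ Finset.range d, (phaseBudget d T (t + 1) : ℝ) ≤
      ((T : ℝ) - d) / (harmonic d : ℝ) * ((d : ℝ) - t)⁻¹ + 1 := by
    intro t ht
    have ht' : (t : ℝ) < d := by exact_mod_cast Finset.mem_range.1 ht
    rw [phaseBudget_succ]
    refine (Nat.ceil_lt_add_one ?_).le.trans_eq ?_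
    · exact div_nonneg (by linarith) (mul_nonneg hH.le (by linarith))
    · rw [← div_eq_mul_inv, div_div]
  have := Finset.sum_le_sum key
  rw [Finset.sum_add_distrib, ← Finset.mul_sum, sum_inv_sub_eq_harmonic,
    div_mul_cancel₀ _ hH.ne'] at this
  simp only [Finset.sum_const, Finset.card_range, nsmul_eq_mul, mul_one, sub_add_cancel] at this
  exact_mod_cast this

/-! ### The complexity measures -/

variable {A : Finset (Fin d → ℝ)} {μ πstar : Fin d → ℝ}

theorem bddAbove_L (A : Finset (Fin d → ℝ)) :
    BddAbove {r : ℝ | ∃ e : Fin d, ∃ π₁ ∈ A, ∃ π₂ ∈ A, ∃ π₃ ∈ A,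
      π₁ e ≠ π₃ e ∧ r = |π₁ e - π₂ e| / |π₁ e - π₃ e|} := by
  refine (((Finset.univ ×ˢ A ×ˢ A ×ˢ A).image fun q : Fin d × (Fin d → ℝ) × (Fin d → ℝ) ×
    (Fin d → ℝ) => |q.2.1 q.1 - q.2.2.1 q.1| / |q.2.1 q.1 - q.2.2.2 q.1|).bddAbove).mono ?_
  rintro r ⟨e, π₁, h₁, π₂, h₂, π₃, h₃, -, rfl⟩
  simp only [Finset.coe_image, Set.mem_image, Finset.mem_coe, Finset.mem_product]
  exact ⟨(e, π₁, π₂, π₃), ⟨Finset.mem_univ _, h₁, h₂, h₃⟩, rfl⟩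

theorem bddAbove_U (A : Finset (Fin d → ℝ)) :
    BddAbove {r : ℝ | ∃ π ∈ A, ∃ π' ∈ A, ∃ e : Fin d,
      π e ≠ π' e ∧ r = (∑ s, |π s - π' s|) / |π e - π' e|} := by
  refine (((A ×ˢ A ×ˢ Finset.univ).image fun q : (Fin d → ℝ) × (Fin d → ℝ) × Fin d =>
    (∑ s, |q.1 s - q.2.1 s|) / |q.1 q.2.2 - q.2.1 q.2.2|).bddAbove).mono ?_
  rintro r ⟨π, h, π', h', e, -, rfl⟩
  simp only [Finset.coe_image, Set.mem_image, Finset.mem_coe, Finset.mem_product]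
  exact ⟨(π, π', e), ⟨h, h', Finset.mem_univ _⟩, rfl⟩

theorem abs_sub_le_L_mul {e : Fin d} {π₁ π₂ π₃ : Fin d → ℝ} (h₁ : π₁ ∈ A) (h₂ : π₂ ∈ A)
    (h₃ : π₃ ∈ A) (h : π₁ e ≠ π₃ e) : |π₁ e - π₂ e| ≤ L A * |π₁ e - π₃ e| := by
  rw [← div_le_iff₀ (abs_pos.2 (sub_ne_zero.2 h))]
  exact le_csSup (bddAbove_L A) ⟨e, π₁, h₁, π₂, h₂, π₃, h₃, h, rfl⟩

theorem sum_abs_sub_le_U_mul {e : Fin d} {π π' : Fin d → ℝ} (h : π ∈ A) (h' : π' ∈ A)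
    (hne : π e ≠ π' e) : ∑ s, |π s - π' s| ≤ U A * |π e - π' e| := by
  rw [← div_le_iff₀ (abs_pos.2 (sub_ne_zero.2 hne))]
  exact le_csSup (bddAbove_U A) ⟨π, h, π', h', e, hne, rfl⟩

theorem one_le_L {e : Fin d} {π π' : Fin d → ℝ} (h : π ∈ A) (h' : π' ∈ A)
    (hne : π e ≠ π' e) : 1 ≤ L A := by
  have hpos := abs_pos.2 (sub_ne_zero.2 hne)
  have := abs_sub_le_L_mul h h' h' hne
  exact le_of_mul_le_mul_right (by linarith) hpos

theorem one_le_U {e : Fin d} {π π' : Fin d → ℝ} (h : π ∈ A) (h' : π' ∈ A)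
    (hne : π e ≠ π' e) : 1 ≤ U A := by
  have hpos := abs_pos.2 (sub_ne_zero.2 hne)
  have h1 := sum_abs_sub_le_U_mul h h' hne
  have h2 : |π e - π' e| ≤ ∑ s, |π s - π' s| :=
    Finset.single_le_sum (f := fun s => |π s - π' s|) (fun _ _ => abs_nonneg _)
      (Finset.mem_univ e)
  exact le_of_mul_le_mul_right (by linarith) hpos

theorem dotProduct_sub_nonneg (hbest : IsBestAction A μ πstar) {π : Fin d → ℝ} (h : π ∈ A) :
    0 ≤ μ ⬝ᵥ (πstar - π) := by
  rw [dotProduct_sub, sub_nonneg]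
  by_cases heq : π = πstar
  · rw [heq]
  · exact (hbest.2 π h heq).le

theorem gap_le {π : Fin d → ℝ} (h : π ∈ A) {s : Fin d} (hs : π s ≠ πstar s) :
    gap A μ πstar s ≤ ENNReal.ofReal (μ ⬝ᵥ (πstar - π) / |πstar s - π s|) :=
  (iInf₂_le π h).trans (iInf_le _ hs)

/-- A finite minimum of ratios whose numerators are positive by uniqueness of the maximizer. -/
theorem gap_pos (hbest : IsBestAction A μ πstar) (s : Fin d) : 0 < gap A μ πstar s := by
  classical
  by_cases hne : ∃ π ∈ A, π s ≠ πstar s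
  · obtain ⟨π, hπ, hmin⟩ := (A.filter fun π => π s ≠ πstar s).exists_min_image
      (fun π => μ ⬝ᵥ (πstar - π) / |πstar s - π s|) (by
        obtain ⟨π, h, h'⟩ := hne
        exact ⟨π, Finset.mem_filter.2 ⟨h, h'⟩⟩)
    rw [Finset.mem_filter] at hπ
    have hlt := hbest.2 π hπ.1 fun h => hπ.2 (by rw [h])
    have hpos : 0 < μ ⬝ᵥ (πstar - π) / |πstar s - π s| := by
      apply div_pos
      · rw [dotProduct_sub]
        linarith
      · exact abs_pos.2 (sub_ne_zero.2 hπ.2.symm)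
    refine (ENNReal.ofReal_pos.2 hpos).trans_le ?_
    refine le_iInf₂ fun π' h' => le_iInf fun hs' => ENNReal.ofReal_le_ofReal ?_
    exact hmin π' (Finset.mem_filter.2 ⟨h', hs'⟩)
  · push Not at hne
    have : gap A μ πstar s = ⊤ := by
      simp only [gap, iInf_eq_top]
      exact fun π h hs => absurd (hne π h) hs
    simp [this]

theorem mul_abs_sub_le_of_le_gap (hbest : IsBestAction A μ πstar) {Δ : ℝ≥0∞} {s : Fin d}
    (hΔ : Δ ≤ gap A μ πstar s) {π : Fin d → ℝ} (h : π ∈ A) (hs : π s ≠ πstar s) :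
    Δ ≠ ⊤ ∧ Δ.toReal * |πstar s - π s| ≤ μ ⬝ᵥ (πstar - π) := by
  have hle := hΔ.trans (gap_le (μ := μ) h hs)
  refine ⟨ne_top_of_le_ne_top ENNReal.ofReal_ne_top hle, ?_⟩
  have hpos : 0 < |πstar s - π s| := abs_pos.2 (sub_ne_zero.2 hs.symm)
  rw [← le_div_iff₀ hpos]
  exact ENNReal.toReal_le_of_le_ofReal (div_nonneg (dotProduct_sub_nonneg hbest h) hpos.le) hle

/-- Pigeonhole: `t + 1` sorted positions are at or above `d - 1 - t`, so their arms cannot all lie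
in `F`. -/
theorem exists_sortedGap_le_gap (A : Finset (Fin d → ℝ)) (μ πstar : Fin d → ℝ)
    (F : Finset (Fin d)) {t : ℕ} (hF : F.card = t) (ht : t < d) :
    ∃ j ∉ F, sortedGap A μ πstar ⟨d - 1 - t, by omega⟩ ≤ gap A μ πstar j := by
  by_contra! hcon
  set k : Fin d := ⟨d - 1 - t, by omega⟩
  have hsub : (Finset.Ici k).map (Tuple.sort (gap A μ πstar)).toEmbedding ⊆ F := by
    intro j hj
    obtain ⟨i, hi, rfl⟩ := Finset.mem_map.1 hj
    by_contra hjF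
    exact absurd (Tuple.monotone_sort (gap A μ πstar) (Finset.mem_Ici.1 hi))
      (not_le.2 (hcon _ hjF))
  have := Finset.card_le_card hsub
  rw [Finset.card_map, Fin.card_Ici, hF] at this
  have hk : (k : ℕ) = d - 1 - t := rfl
  omega

theorem H2_ne_top (hbest : IsBestAction A μ πstar) : H2 A μ πstar ≠ ⊤ := by
  refine ne_of_lt (iSup_lt_iff.2 ?_)
  refine ⟨∑ s : Fin d, (((s : ℕ) + 1 : ℕ) : ℝ≥0∞) / sortedGap A μ πstar s ^ 2, ?_, fun s => ?_⟩
  · refine ENNReal.sum_lt_top.2 fun s _ => ENNReal.div_lt_top (ENNReal.natCast_ne_top _) ?_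
    exact pow_ne_zero _ (gap_pos hbest _).ne'
  · exact Finset.single_le_sum
      (f := fun s : Fin d => (((s : ℕ) + 1 : ℕ) : ℝ≥0∞) / sortedGap A μ πstar s ^ 2)
      (fun _ _ => zero_le) (Finset.mem_univ s)

/-- This covers infinite gaps too: their `toReal` is 0, and division by zero makes the left side 0.
-/
theorem div_sq_le_H2_toReal (hbest : IsBestAction A μ πstar) (s : Fin d) :
    ((s : ℝ) + 1) / (sortedGap A μ πstar s).toReal ^ 2 ≤ (H2 A μ πstar).toReal := by
  have h := ENNReal.toReal_mono (H2_ne_top hbest)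
    (le_iSup (fun s : Fin d => (((s : ℕ) + 1 : ℕ) : ℝ≥0∞) / sortedGap A μ πstar s ^ 2) s)
  rw [ENNReal.toReal_div, ENNReal.toReal_pow, ENNReal.toReal_natCast] at h
  exact_mod_cast h

/-! ### Correctness of a single assignment -/

/-- Feasible actions agree on `F`, so only accurate coordinates contribute; `U` then trades the ℓ¹
distance for the single coordinate `e`, which also supplies strictness. -/
theorem abs_dotProduct_sub_lt {S : Finset (Fin d × ℝ)} {F : Finset (Fin d)} {c : ℝ}
    (hc : ∀ π ∈ feasible A S, ∀ e ∈ F, π e = πstar e) {ν : Fin d → ℝ}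
    (hν : ∀ e ∉ F, |ν e - μ e| < c / U A) {π π' : Fin d → ℝ} (h : π ∈ feasible A S)
    (h' : π' ∈ feasible A S) {e : Fin d} (hne : π e ≠ π' e) :
    |(ν - μ) ⬝ᵥ (π - π')| < c * |π e - π' e| := by
  have hU : 0 < U A := zero_lt_one.trans_le (one_le_U h.1 h'.1 hne)
  have heF : e ∉ F := fun he => hne ((hc π h e he).trans (hc π' h' e he).symm)
  have hcU : 0 < c / U A := (abs_nonneg _).trans_lt (hν e heF)
  calc |(ν - μ) ⬝ᵥ (π - π')| ≤ ∑ s, |ν s - μ s| * |π s - π' s| := by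
        refine (Finset.abs_sum_le_sum_abs _ _).trans_eq ?_
        simp [abs_mul]
    _ < ∑ s, c / U A * |π s - π' s| := by
        refine Finset.sum_lt_sum (fun s _ => ?_) ⟨e, Finset.mem_univ e, ?_⟩
        · by_cases hs : s ∈ F
          · simp [(hc π h s hs).trans (hc π' h' s hs).symm]
          · exact mul_le_mul_of_nonneg_right (hν s hs).le (abs_nonneg _)
        · exact mul_lt_mul_of_pos_right (hν e heF) (abs_pos.2 (sub_ne_zero.2 hne))
    _ = c / U A * ∑ s, |π s - π' s| := by rw [Finset.mul_sum]
    _ ≤ c / U A * (U A * |π e - π' e|) :=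
        mul_le_mul_of_nonneg_left (sum_abs_sub_le_U_mul h.1 h'.1 hne) hcU.le
    _ = c * |π e - π' e| := by field_simp

theorem ask_eq_some_imp (O : COracle A) {ν : Fin d → ℝ} {S : Finset (Fin d × ℝ)}
    {π : Fin d → ℝ} (h : O.ask ν S = some π) :
    π ∈ feasible A S ∧ ∀ π' ∈ feasible A S, ν ⬝ᵥ π' ≤ ν ⬝ᵥ π := by
  rcases (feasible A S).eq_empty_or_nonempty with he | hne
  · rw [O.ask_of_empty ν S he] at h
    cases h
  · obtain ⟨π', hf, hask, hmax⟩ := O.ask_of_nonempty ν S hne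
    rw [hask, Option.some.injEq] at h
    exact h ▸ ⟨hf, hmax⟩

theorem mem_feasible_insert {S : Finset (Fin d × ℝ)} {e : Fin d} {x : ℝ} {π : Fin d → ℝ} :
    π ∈ feasible A (insert (e, x) S) ↔ π e = x ∧ π ∈ feasible A S := by
  simp only [feasible, Set.mem_ofPred_eq, Finset.forall_mem_insert]
  tauto

theorem challenger_eq_some_imp (O : COracle A) (ruleX : ArgmaxRule ℝ) {ν πhat q : Fin d → ℝ}
    {S : Finset (Fin d × ℝ)} {e : Fin d} (h : challenger O ruleX ν S πhat e = some q) :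
    q ∈ feasible A S ∧ q e ≠ πhat e := by
  unfold challenger at h
  split_ifs at h with hne
  have hsel := ruleX.sel_mem _ hne fun x => value ν (O.ask ν (insert (e, x) S))
  obtain ⟨hq, hqS⟩ := mem_feasible_insert.1 (ask_eq_some_imp O h).1
  exact ⟨hqS, hq ▸ Finset.ne_of_mem_erase hsel⟩

/-- The query for the value `π e` already does at least as well as `π`, and the challenger is the
best over all queries. -/
theorem challenger_of_feasible (O : COracle A) (ruleX : ArgmaxRule ℝ) {ν πhat π : Fin d → ℝ}
    {S : Finset (Fin d × ℝ)} {e : Fin d} (hπ : π ∈ feasible A S) (hne : π e ≠ πhat e) :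
    ∃ q, challenger O ruleX ν S πhat e = some q ∧ ν ⬝ᵥ π ≤ ν ⬝ᵥ q := by
  have hmem : π e ∈ (possiblePi A e).erase (πhat e) :=
    Finset.mem_erase.2 ⟨hne, Finset.mem_image_of_mem _ hπ.1⟩
  have hπ' : π ∈ feasible A (insert (e, π e) S) := mem_feasible_insert.2 ⟨rfl, hπ⟩
  obtain ⟨π', -, hask, hmax⟩ := O.ask_of_nonempty ν _ ⟨π, hπ'⟩
  have hsel := ruleX.le_sel _ ⟨_, hmem⟩ (fun x => value ν (O.ask ν (insert (e, x) S))) _ hmem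
  unfold challenger
  rw [dif_pos ⟨_, hmem⟩]
  simp only [hask] at hsel
  cases hq : O.ask ν (insert (e, ruleX.sel _ ⟨_, hmem⟩
      fun x => value ν (O.ask ν (insert (e, x) S))) S) with
  | none =>
    rw [hq] at hsel
    simp [value] at hsel
  | some q =>
    rw [hq] at hsel
    simp only [value, EReal.coe_le_coe_iff] at hsel
    exact ⟨q, rfl, (hmax π hπ').trans hsel⟩

/-- If the assignments made so far are correct and the empirical means of the remaining arms are
accurate relative to a lower bound `Δ` on the gap of some remaining arm, then an arm of maximal
empirical gap is assigned its correct value. -/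
theorem selected_value_eq (hbest : IsBestAction A μ πstar) (O : COracle A)
    (ruleX : ArgmaxRule ℝ) {S : Finset (Fin d × ℝ)} {F : Finset (Fin d)}
    (hF : ∀ π ∈ feasible A S, ∀ e ∈ F, π e = πstar e) (hstar : πstar ∈ feasible A S)
    {ν πhat : Fin d → ℝ} (hhat : O.ask ν S = some πhat) {Δ : ℝ≥0∞} {j p : Fin d}
    (hj : Δ ≤ gap A μ πstar j)
    (hp : empGap ν πhat j (challenger O ruleX ν S πhat j) ≤
      empGap ν πhat p (challenger O ruleX ν S πhat p))
    (hν : Δ ≠ ⊤ → ∀ e ∉ F, |ν e - μ e| < Δ.toReal / (1 + L A) / U A) :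
    πhat p = πstar p := by
  by_contra hne
  obtain ⟨hfeas, hmax⟩ := ask_eq_some_imp O hhat
  obtain ⟨q, hq, hqval⟩ := challenger_of_feasible O ruleX (ν := ν) (πhat := πhat) hstar
    (Ne.symm hne)
  obtain ⟨hqS, hqp⟩ := challenger_eq_some_imp O ruleX hq
  rw [hq] at hp
  cases hr : challenger O ruleX ν S πhat j with
  | none =>
    -- Without a challenger the empirical gap of `j` is `⊤`, above the finite one of `p`.
    rw [hr] at hp
    simp [empGap] at hp
  | some r =>
    rw [hr] at hp
    simp only [empGap, EReal.coe_le_coe_iff] at hp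
    obtain ⟨hrS, hrj⟩ := challenger_eq_some_imp O ruleX hr
    have hL : 1 ≤ L A := one_le_L hfeas.1 hstar.1 hne
    -- `r` and `πhat` differ at `j`, so one of them differs from `πstar` there and witnesses a
    -- finite gap.
    have hΔtop : Δ ≠ ⊤ := by
      by_cases hrs : r j = πstar j
      · exact (mul_abs_sub_le_of_le_gap hbest hj hfeas.1 fun h => hrj (hrs.trans h.symm)).1
      · exact (mul_abs_sub_le_of_le_gap hbest hj hrS.1 hrs).1
    -- This `c` solves Δ - c = cL, so the lower bound for `j` and the upper bound for `p` meet at `c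
    -- * L A`.
    set c := Δ.toReal / (1 + L A) with hc
    have hΔc : Δ.toReal = c * (1 + L A) := by rw [hc]; field_simp
    have hc0 : 0 ≤ c := div_nonneg ENNReal.toReal_nonneg (by linarith)
    have hdev {π π' : Fin d → ℝ} (h : π ∈ feasible A S) (h' : π' ∈ feasible A S) {e : Fin d}
        (hee : π e ≠ π' e) := abs_dotProduct_sub_lt hF (hν hΔtop) h h' hee
    have hsplit : ∀ v : Fin d → ℝ, ν ⬝ᵥ v = (ν - μ) ⬝ᵥ v + μ ⬝ᵥ v := fun v => by
      rw [sub_dotProduct]; ring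
    have hneg : μ ⬝ᵥ (πhat - πstar) = -(μ ⬝ᵥ (πstar - πhat)) := by
      rw [← neg_sub πstar πhat, dotProduct_neg]
    have hhatstar : 0 ≤ ν ⬝ᵥ (πhat - πstar) := by
      rw [dotProduct_sub, sub_nonneg]
      exact hmax _ hstar
    by_cases hjs : πhat j = πstar j
    · have hrs : r j ≠ πstar j := hjs ▸ hrj
      have hposj : 0 < |πhat j - r j| := abs_pos.2 (sub_ne_zero.2 hrj.symm)
      have hposp : 0 < |πhat p - q p| := abs_pos.2 (sub_ne_zero.2 hqp.symm)
      have h1 := (mul_abs_sub_le_of_le_gap hbest hj hrS.1 hrs).2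
      have h2 := neg_lt_of_abs_lt (hdev hstar hrS hrs.symm)
      have h3 : ν ⬝ᵥ (πstar - r) ≤ ν ⬝ᵥ (πhat - r) := by
        rw [dotProduct_sub, dotProduct_sub]
        linarith [hmax _ hstar]
      have hlow : c * L A < ν ⬝ᵥ (πhat - r) / |πhat j - r j| := by
        rw [lt_div_iff₀ hposj]
        rw [hsplit (πstar - r)] at h3
        rw [hΔc] at h1
        rw [← hjs] at h1 h2
        linarith
      have h4 := lt_of_abs_lt (hdev hfeas hstar hne)
      have h5 := dotProduct_sub_nonneg hbest hfeas.1
      -- The bound for `p` is relative to |π̂_p - π*_p|; `L` converts it to the denominator |π̂_p -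
      -- q_p| of the empirical gap.
      have h6 := mul_le_mul_of_nonneg_left
        (abs_sub_le_L_mul hfeas.1 hstar.1 hqS.1 hqp.symm) hc0
      have hhigh : ν ⬝ᵥ (πhat - q) / |πhat p - q p| < c * L A := by
        rw [div_lt_iff₀ hposp]
        have h7 : ν ⬝ᵥ (πhat - q) ≤ ν ⬝ᵥ (πhat - πstar) := by
          rw [dotProduct_sub, dotProduct_sub]
          linarith
        rw [hsplit (πhat - πstar)] at h7
        linarith
      linarith
    -- The true deficit of `πhat` is at least (1+L)c times its distance to `πstar` at `j`, more than
    -- the estimation error can hide.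
    · have h1 := (mul_abs_sub_le_of_le_gap hbest hj hfeas.1 hjs).2
      have h2 := lt_of_abs_lt (hdev hfeas hstar hjs)
      rw [hsplit] at hhatstar
      rw [hΔc, abs_sub_comm] at h1
      have h3 : 0 ≤ c * L A * |πhat j - πstar j| := by positivity
      linarith

/-! ### The run of the algorithm -/

theorem phase_eq (O : COracle A) (ruleX : ArgmaxRule ℝ) (ruleP : ArgmaxRule (Fin d)) (T : ℕ)
    (x : Fin d → ℕ → ℝ) (t : ℕ) {σ : State d} (hσ : σ.failed = false)
    (hS : (feasible A σ.S).Nonempty) (hF : (Finset.univ \ σ.F).Nonempty) :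
    ∃ πhat p, O.ask (empMean x (pullActive T t σ.F σ.N)) σ.S = some πhat ∧ p ∉ σ.F ∧
      (∀ e ∉ σ.F,
        empGap (empMean x (pullActive T t σ.F σ.N)) πhat e
          (challenger O ruleX (empMean x (pullActive T t σ.F σ.N)) σ.S πhat e) ≤
        empGap (empMean x (pullActive T t σ.F σ.N)) πhat p
          (challenger O ruleX (empMean x (pullActive T t σ.F σ.N)) σ.S πhat p)) ∧
      phase O ruleX ruleP T x t σ =
        { F := insert p σ.F
          S := insert (p, πhat p) σ.S
          N := pullActive T t σ.F σ.N
          failed := false } := by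
  classical
  set ν := empMean x (pullActive T t σ.F σ.N) with hν
  obtain ⟨πhat, -, hask, -⟩ := O.ask_of_nonempty ν σ.S hS
  refine ⟨πhat, ruleP.sel _ hF fun e => empGap ν πhat e (challenger O ruleX ν σ.S πhat e),
    hask, ?_, fun e he => ?_, ?_⟩
  · have h := ruleP.sel_mem _ hF fun e => empGap ν πhat e (challenger O ruleX ν σ.S πhat e)
    exact (Finset.mem_sdiff.1 h).2
  · exact ruleP.le_sel _ hF (fun e => empGap ν πhat e (challenger O ruleX ν σ.S πhat e)) e
      (Finset.mem_sdiff.2 ⟨Finset.mem_univ e, he⟩)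
  · unfold phase
    rw [hσ]
    simp only [Bool.false_eq_true, if_false]
    rw [← hν, hask]
    simp only
    rw [dif_pos hF]

/-- The invariant of the state after `t` phases: `t` arms have been assigned values by some common
action, and the other arms have been pulled `T̃(t)` times. -/
structure Invariant (A : Finset (Fin d → ℝ)) (T t : ℕ) (σ : State d) : Prop where
  failed_eq : σ.failed = false
  card_F : σ.F.card = t
  exists_S_eq : ∃ π ∈ A, σ.S = σ.F.image fun e => (e, π e)
  N_eq : ∀ e ∉ σ.F, σ.N e = phaseBudget d T t
  sum_N : ∑ e ∈ σ.F, σ.N e = ∑ i ∈ Finset.range t, phaseBudget d T (i + 1)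

theorem mem_feasible_image {F : Finset (Fin d)} {π π' : Fin d → ℝ} :
    π' ∈ feasible A (F.image fun e => (e, π e)) ↔ π' ∈ A ∧ ∀ e ∈ F, π' e = π e := by
  simp [feasible]

theorem Invariant.feasible_nonempty {T t : ℕ} {σ : State d} (h : Invariant A T t σ) :
    (feasible A σ.S).Nonempty := by
  obtain ⟨π, hπ, hS⟩ := h.exists_S_eq
  exact ⟨π, hS ▸ mem_feasible_image.2 ⟨hπ, fun _ _ => rfl⟩⟩

theorem Invariant.eq_of_feasible {T t : ℕ} {σ : State d} (h : Invariant A T t σ)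
    {π π' : Fin d → ℝ} (hπ : π ∈ feasible A σ.S) (hπ' : π' ∈ feasible A σ.S) :
    ∀ e ∈ σ.F, π e = π' e := by
  obtain ⟨π₀, -, hS⟩ := h.exists_S_eq
  rw [hS, mem_feasible_image] at hπ hπ'
  exact fun e he => (hπ.2 e he).trans (hπ'.2 e he).symm

theorem Invariant.exists_not_mem {T t : ℕ} {σ : State d} (h : Invariant A T t σ) (ht : t < d) :
    (Finset.univ \ σ.F).Nonempty := by
  rw [← Finset.card_pos, Finset.card_sdiff_of_subset (Finset.subset_univ _), Finset.card_univ,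
    Fintype.card_fin, h.card_F]
  omega

theorem Invariant.pullActive_eq {T t : ℕ} {σ : State d} (h : Invariant A T t σ) (hT : d < T)
    (ht : t < d) {e : Fin d} (he : e ∉ σ.F) :
    pullActive T (t + 1) σ.F σ.N e = phaseBudget d T (t + 1) := by
  rw [pullActive, if_neg he, h.N_eq e he, Nat.add_sub_cancel,
    Nat.add_sub_cancel' (phaseBudget_le_succ hT ht)]

/-- `πhat` itself is the new common action, and the count of `p` freezes at T̃(t + 1), the new
summand of the total. -/
theorem Invariant.insert {T t : ℕ} {σ : State d} (h : Invariant A T t σ) (hT : d < T)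
    (ht : t < d) {πhat : Fin d → ℝ} (hhat : πhat ∈ feasible A σ.S) {p : Fin d}
    (hp : p ∉ σ.F) :
    Invariant A T (t + 1)
      { F := insert p σ.F
        S := insert (p, πhat p) σ.S
        N := pullActive T (t + 1) σ.F σ.N
        failed := false } := by
  refine ⟨rfl, ?_, ⟨πhat, hhat.1, ?_⟩, ?_, ?_⟩
  · simp only
    rw [Finset.card_insert_of_notMem hp, h.card_F]
  · obtain ⟨π, hπ, hS⟩ := h.exists_S_eq
    simp only [Finset.image_insert]
    rw [hS] at hhat ⊢
    congr 1
    refine Finset.image_congr fun e he => ?_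
    rw [(mem_feasible_image.1 hhat).2 e he]
  · intro e he
    exact h.pullActive_eq hT ht fun h' => he (Finset.mem_insert_of_mem h')
  · simp only
    rw [Finset.sum_insert hp, h.pullActive_eq hT ht hp, Finset.sum_range_succ, ← h.sum_N, add_comm]
    congr 1
    exact Finset.sum_congr rfl fun e he => by rw [pullActive, if_pos he]

theorem invariant_stateAfter (O : COracle A) (ruleX : ArgmaxRule ℝ) (ruleP : ArgmaxRule (Fin d))
    {T : ℕ} (hT : d < T) (hA : A.Nonempty) (x : Fin d → ℕ → ℝ) {t : ℕ} (ht : t ≤ d) :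
    Invariant A T t (stateAfter O ruleX ruleP T x t) := by
  induction t with
  | zero =>
    obtain ⟨π, hπ⟩ := hA
    exact ⟨rfl, rfl, ⟨π, hπ, rfl⟩, fun _ _ => rfl, rfl⟩
  | succ t ih =>
    have h := ih (by omega)
    obtain ⟨πhat, p, hask, hp, -, heq⟩ := phase_eq O ruleX ruleP T x (t + 1) h.failed_eq
      h.feasible_nonempty (h.exists_not_mem (by omega))
    rw [stateAfter, heq]
    exact h.insert hT (by omega) (ask_eq_some_imp O hask).1 hp

theorem toVector_image_univ (π : Fin d → ℝ) :
    toVector (Finset.univ.image fun e => (e, π e)) = π := by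
  funext e
  have h : ∃ x, (e, x) ∈ Finset.univ.image fun e => (e, π e) :=
    ⟨π e, Finset.mem_image.2 ⟨e, Finset.mem_univ e, rfl⟩⟩
  rw [toVector, dif_pos h]
  obtain ⟨e', -, he'⟩ := Finset.mem_image.1 h.choose_spec
  rw [Prod.mk.injEq] at he'
  rw [← he'.2, he'.1]

theorem Invariant.F_eq_univ {T : ℕ} {σ : State d} (h : Invariant A T d σ) :
    σ.F = Finset.univ := by
  rw [← Finset.card_eq_iff_eq_univ, h.card_F, Fintype.card_fin]

theorem samples_le (O : COracle A) (ruleX : ArgmaxRule ℝ) (ruleP : ArgmaxRule (Fin d))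
    {T : ℕ} (hT : d < T) (hA : A.Nonempty) (x : Fin d → ℕ → ℝ) :
    samples O ruleX ruleP T x ≤ T := by
  have h := invariant_stateAfter O ruleX ruleP hT hA x le_rfl
  rw [samples, ← h.F_eq_univ, h.sum_N]
  exact sum_phaseBudget_le hT

theorem exists_output_eq (O : COracle A) (ruleX : ArgmaxRule ℝ) (ruleP : ArgmaxRule (Fin d))
    {T : ℕ} (hT : d < T) (hA : A.Nonempty) (x : Fin d → ℕ → ℝ) :
    ∃ π ∈ A, output O ruleX ruleP T x = some π ∧
      (stateAfter O ruleX ruleP T x d).S = Finset.univ.image fun e => (e, π e) := by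
  have h := invariant_stateAfter O ruleX ruleP hT hA x le_rfl
  obtain ⟨π, hπ, hS⟩ := h.exists_S_eq
  rw [h.F_eq_univ] at hS
  refine ⟨π, hπ, ?_, hS⟩
  rw [output, h.failed_eq, hS, toVector_image_univ]
  simp

/-- The empirical mean of arm `e` over the pulls of the phases `1, …, t`. -/
noncomputable def phaseMean (T : ℕ) (x : Fin d → ℕ → ℝ) (t : ℕ) (e : Fin d) : ℝ :=
  empMean x (fun _ => phaseBudget d T t) e

/-- If all empirical means are accurate in every phase, then the best action is returned. -/
theorem output_eq_of_accurate (hbest : IsBestAction A μ πstar) (O : COracle A)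
    (ruleX : ArgmaxRule ℝ) (ruleP : ArgmaxRule (Fin d)) {T : ℕ} (hT : d < T)
    (x : Fin d → ℕ → ℝ)
    (hx : ∀ t : Fin d, sortedGap A μ πstar t.rev ≠ ⊤ → ∀ e,
      |phaseMean T x (t + 1) e - μ e| <
        (sortedGap A μ πstar t.rev).toReal / (1 + L A) / U A) :
    output O ruleX ruleP T x = some πstar := by
  have hA : A.Nonempty := ⟨πstar, hbest.1⟩
  have key : ∀ t ≤ d, πstar ∈ feasible A (stateAfter O ruleX ruleP T x t).S := by
    intro t
    induction t with
    | zero => exact fun _ => ⟨hbest.1, fun q hq => by simp [stateAfter, State.init] at hq⟩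
    | succ t ih =>
      intro ht
      have hstar := ih (by omega)
      have h := invariant_stateAfter O ruleX ruleP hT hA x (t := t) (by omega)
      obtain ⟨πhat, p, hask, hp, hmax, heq⟩ := phase_eq O ruleX ruleP T x (t + 1) h.failed_eq
        h.feasible_nonempty (h.exists_not_mem (by omega))
      obtain ⟨j, hjF, hj⟩ := exists_sortedGap_le_gap A μ πstar _ h.card_F (by omega)
      -- Zero-based, `Fin.rev` of `t` is the position of Δ_(d-t).
      have hrev : (⟨d - 1 - t, by omega⟩ : Fin d) = Fin.rev ⟨t, by omega⟩ := by
        ext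
        simp only [Fin.val_rev]
        omega
      rw [hrev] at hj
      rw [stateAfter, heq]
      refine mem_feasible_insert.2 ⟨?_, hstar⟩
      refine (selected_value_eq hbest O ruleX (fun π hπ => h.eq_of_feasible hπ hstar) hstar hask
        hj (hmax j hjF) fun htop e he => ?_).symm
      have := hx ⟨t, by omega⟩ htop e
      simpa only [phaseMean, empMean, h.pullActive_eq hT (by omega : t < d) he] using this
  obtain ⟨π, -, hout, hS⟩ := exists_output_eq O ruleX ruleP hT hA x
  have hfin := key d le_rfl
  rw [hS, mem_feasible_image] at hfin
  rw [hout, Option.some.injEq]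
  exact funext fun e => (hfin.2 e (Finset.mem_univ e)).symm

/-- With a single arm, the output maximizes the empirical value. -/
theorem exists_output_eq_maximizer {A : Finset (Fin 1 → ℝ)} (O : COracle A)
    (ruleX : ArgmaxRule ℝ) (ruleP : ArgmaxRule (Fin 1)) {T : ℕ} (hT : 1 < T) (hA : A.Nonempty)
    (x : Fin 1 → ℕ → ℝ) :
    ∃ π ∈ A, output O ruleX ruleP T x = some π ∧
      ∀ π' ∈ A, phaseMean T x 1 0 * π' 0 ≤ phaseMean T x 1 0 * π 0 := by
  have h := invariant_stateAfter O ruleX ruleP hT hA x (t := 0) (by omega)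
  obtain ⟨πhat, p, hask, hp, -, heq⟩ := phase_eq O ruleX ruleP T x 1 h.failed_eq
    h.feasible_nonempty (h.exists_not_mem (by omega))
  obtain ⟨π, hπ, hout, hS⟩ := exists_output_eq O ruleX ruleP hT hA x
  obtain ⟨-, hmax⟩ := ask_eq_some_imp O hask
  refine ⟨π, hπ, hout, fun π' hπ' => ?_⟩
  rw [stateAfter, heq] at hS
  have hmem : (p, πhat p) ∈ Finset.univ.image fun e => (e, π e) :=
    hS ▸ Finset.mem_insert_self _ _
  obtain ⟨e, -, he⟩ := Finset.mem_image.1 hmem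
  rw [Prod.mk.injEq] at he
  have hp0 : p = 0 := Subsingleton.elim _ _
  have hval := hmax π' ⟨hπ', fun q hq => by simp [stateAfter, State.init] at hq⟩
  have h0 : (0 : Fin 1) ∉ (stateAfter O ruleX ruleP T x 0).F := by
    simp [stateAfter, State.init]
  simp only [dotProduct, Fin.sum_univ_one, empMean,
    h.pullActive_eq hT (by omega : 0 < 1) h0] at hval
  rw [he.1, hp0] at he
  rw [he.2]
  exact hval

/-! ### Concentration of the empirical means -/

section Concentration

variable {Ω : Type*} [MeasurableSpace Ω] {P : Measure Ω} {Y : ℕ → Ω → ℝ} {c : ℝ≥0}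

theorem measureReal_le_mean_sub_le (hindep : iIndepFun Y P) {m : ℝ}
    (hY : ∀ i, HasSubgaussianMGF (fun ω => Y i ω - m) c P) {n : ℕ} (hn : 0 < n) {ε : ℝ}
    (hε : 0 ≤ ε) :
    P.real {ω | ε ≤ (∑ i ∈ Finset.range n, Y i ω) / n - m} ≤
      Real.exp (-(n * ε ^ 2 / (2 * c))) := by
  have hn' : (0 : ℝ) < n := by exact_mod_cast hn
  have hind : iIndepFun (fun i ω => Y i ω - m) P :=
    hindep.comp (fun _ y => y - m) fun _ => measurable_id.sub_const m
  have h := HasSubgaussianMGF.measure_sum_range_ge_le_of_iIndepFun hind (n := n) (fun i _ => hY i)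
    (mul_nonneg hn'.le hε)
  have hset : {ω | ε ≤ (∑ i ∈ Finset.range n, Y i ω) / n - m} =
      {ω | n * ε ≤ ∑ i ∈ Finset.range n, (Y i ω - m)} := by
    ext ω
    simp only [Set.mem_ofPred_eq, Finset.sum_sub_distrib, Finset.sum_const, Finset.card_range,
      nsmul_eq_mul]
    rw [le_sub_iff_add_le, le_div_iff₀ hn', le_sub_iff_add_le]
    ring_nf
  rw [hset]
  refine h.trans_eq (congrArg Real.exp ?_)
  rw [neg_div]
  congr 1
  -- For `c = 0` both exponents are divisions by zero, hence 0.
  by_cases hc : (c : ℝ) = 0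
  · simp [hc]
  · field_simp

theorem measureReal_le_sub_mean_le (hindep : iIndepFun Y P) {m : ℝ}
    (hY : ∀ i, HasSubgaussianMGF (fun ω => Y i ω - m) c P) {n : ℕ} (hn : 0 < n) {ε : ℝ}
    (hε : 0 ≤ ε) :
    P.real {ω | ε ≤ m - (∑ i ∈ Finset.range n, Y i ω) / n} ≤
      Real.exp (-(n * ε ^ 2 / (2 * c))) := by
  have hind : iIndepFun (fun i ω => -Y i ω) P :=
    hindep.comp (fun _ y => -y) fun _ => measurable_neg
  have h := measureReal_le_mean_sub_le hind (m := -m) (c := c) (fun i => by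
    refine (hY i).neg.congr (ae_of_all _ fun ω => ?_)
    simp only [Pi.neg_apply]
    ring) hn hε
  refine le_of_eq_of_le (congrArg P.real ?_) h
  ext ω
  simp only [Set.mem_ofPred_eq, Finset.sum_neg_distrib]
  ring_nf

theorem measureReal_le_abs_mean_sub_le [IsFiniteMeasure P] (hindep : iIndepFun Y P) {m : ℝ}
    (hY : ∀ i, HasSubgaussianMGF (fun ω => Y i ω - m) c P) {n : ℕ} (hn : 0 < n) {ε : ℝ}
    (hε : 0 ≤ ε) :
    P.real {ω | ε ≤ |(∑ i ∈ Finset.range n, Y i ω) / n - m|} ≤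
      2 * Real.exp (-(n * ε ^ 2 / (2 * c))) := by
  have hsub : {ω | ε ≤ |(∑ i ∈ Finset.range n, Y i ω) / n - m|} ⊆
      {ω | ε ≤ (∑ i ∈ Finset.range n, Y i ω) / n - m} ∪
        {ω | ε ≤ m - (∑ i ∈ Finset.range n, Y i ω) / n} := by
    intro ω hω
    simp only [Set.mem_union, Set.mem_ofPred_eq] at hω ⊢
    rcases le_abs.1 hω with h | h
    · exact Or.inl h
    · exact Or.inr (by linarith)
  calc _ ≤ _ := measureReal_mono hsub
    _ ≤ _ := measureReal_union_le _ _
    _ ≤ _ := add_le_add (measureReal_le_mean_sub_le hindep hY hn hε)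
      (measureReal_le_sub_mean_le hindep hY hn hε)
    _ = _ := by ring

end Concentration

/-! ### The error probability -/

theorem exponent_le {b h k n Δ l u R H : ℝ} (hb : 0 ≤ b) (hh : 0 < h) (hk : 0 < k)
    (hn : b / (h * k) ≤ n) (hΔ : 0 < Δ) (hH : k / Δ ^ 2 ≤ H) (hl : 1 ≤ l) (hu : 1 ≤ u)
    (hR : 0 < R) :
    9 / 4 * (b / (2 * (2 + l ^ 2) ^ 2 * R ^ 2 * h * u ^ 2 * H)) ≤
      n * (Δ / (1 + l) / u) ^ 2 / (2 * R ^ 2) := by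
  have hu0 : 0 < u := by linarith
  have hl0 : 0 < 1 + l := by linarith
  have hk' : 0 < k / Δ ^ 2 := by positivity
  -- Equivalent to (2l - 1)(l - 1) ≥ 0.
  have hl2 : 3 / 2 * (1 + l) ≤ 2 + l ^ 2 := by nlinarith
  have hl3 : 9 / 4 * (1 + l) ^ 2 ≤ (2 + l ^ 2) ^ 2 := by
    calc 9 / 4 * (1 + l) ^ 2 = (3 / 2 * (1 + l)) ^ 2 := by ring
      _ ≤ _ := pow_le_pow_left₀ (by positivity) hl2 2
  calc 9 / 4 * (b / (2 * (2 + l ^ 2) ^ 2 * R ^ 2 * h * u ^ 2 * H))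
      ≤ 9 / 4 * (b / (2 * (9 / 4 * (1 + l) ^ 2) * R ^ 2 * h * u ^ 2 * (k / Δ ^ 2))) := by
        gcongr
    _ = b / (h * k) * (Δ / (1 + l) / u) ^ 2 / (2 * R ^ 2) := by field_simp
    _ ≤ n * (Δ / (1 + l) / u) ^ 2 / (2 * R ^ 2) := by gcongr

/-- If x ≤ log 2, the claimed bound is at least d²/2 ≥ 2 and hence trivial; otherwise the surplus
5x/4 in the exponent pays for the factor 2. -/
theorem le_mul_exp_of_le_one {d x p : ℝ} (hd : 2 ≤ d) (hp : p ≤ 1)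
    (hpx : p ≤ d ^ 2 * (2 * Real.exp (-(9 / 4 * x)))) : p ≤ d ^ 2 * Real.exp (-x) := by
  rcases le_total x (Real.log 2) with hx | hx
  · have h1 : Real.exp (-Real.log 2) ≤ Real.exp (-x) := Real.exp_le_exp.2 (by linarith)
    rw [Real.exp_neg, Real.exp_log two_pos] at h1
    nlinarith
  · refine hpx.trans (mul_le_mul_of_nonneg_left ?_ (sq_nonneg d))
    have hlog : 0 < Real.log 2 := Real.log_pos one_lt_two
    calc 2 * Real.exp (-(9 / 4 * x)) = Real.exp (Real.log 2 + -(9 / 4 * x)) := by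
          rw [Real.exp_add, Real.exp_log two_pos]
      _ ≤ _ := Real.exp_le_exp.2 (by linarith)

variable {T : ℕ}

theorem le_phaseBudget_mul (hT : d < T) (hbest : IsBestAction A μ πstar) (hL : 1 ≤ L A)
    (hU : 1 ≤ U A) {R : ℝ} (hR : 0 < R) (t : Fin d)
    (ht : sortedGap A μ πstar t.rev ≠ ⊤) :
    9 / 4 * (((T : ℝ) - d) / (2 * (2 + L A ^ 2) ^ 2 * R ^ 2 * (harmonic d : ℝ) * U A ^ 2 *
        (H2 A μ πstar).toReal)) ≤
      phaseBudget d T (t + 1) *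
        ((sortedGap A μ πstar t.rev).toReal / (1 + L A) / U A) ^ 2 / (2 * R ^ 2) := by
  have htd : (t : ℝ) < d := by exact_mod_cast t.2
  have hTd : (d : ℝ) < T := by exact_mod_cast hT
  have hk : ((t.rev : ℕ) : ℝ) + 1 = d - t := by
    have : (t.rev : ℕ) + 1 + t = d := by
      rw [Fin.val_rev]
      omega
    rw [eq_sub_iff_add_eq]
    exact_mod_cast this
  refine exponent_le (k := d - t) (by linarith) (harmonic_cast_pos t.pos) (by linarith) ?_
    (ENNReal.toReal_pos (gap_pos hbest _).ne' ht) ?_ hL hU hR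
  · rw [phaseBudget_succ]
    exact Nat.le_ceil _
  · rw [← hk]
    exact div_sq_le_H2_toReal hbest t.rev

theorem phaseBudget_pos (hT : d < T) (t : Fin d) : 0 < phaseBudget d T (t + 1) := by
  have htd : (t : ℝ) < d := by exact_mod_cast t.2
  have hTd : (d : ℝ) < T := by exact_mod_cast hT
  rw [phaseBudget_succ, Nat.ceil_pos]
  exact div_pos (by linarith) (mul_pos (harmonic_cast_pos t.pos) (by linarith))

theorem measureReal_output_ne_le (hT : d < T) (hbest : IsBestAction A μ πstar) (hL : 1 ≤ L A)
    (hU : 1 ≤ U A) {R : ℝ≥0} (hR : 0 < R) {Ω : Type*} [MeasurableSpace Ω] {P : Measure Ω}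
    [IsProbabilityMeasure P] {X : Fin d → ℕ → Ω → ℝ}
    (hX : ∀ s i, HasSubgaussianMGF (fun ω => X s i ω - μ s) (R ^ 2) P)
    (hindep : ∀ s, iIndepFun (X s) P)
    (O : COracle A) (ruleX : ArgmaxRule ℝ) (ruleP : ArgmaxRule (Fin d)) :
    P.real {ω | output O ruleX ruleP T (fun s i => X s i ω) ≠ some πstar} ≤
      (d : ℝ) ^ 2 * (2 * Real.exp (-(9 / 4 * (((T : ℝ) - d) /
        (2 * (2 + L A ^ 2) ^ 2 * (R : ℝ) ^ 2 * (harmonic d : ℝ) * U A ^ 2 *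
          (H2 A μ πstar).toReal))))) := by
  -- The bad events involve fixed prefixes of the reward table, not the run; phases whose gap bound
  -- is infinite contribute nothing.
  set B : Fin d → Fin d → Set Ω := fun t e => {ω | sortedGap A μ πstar t.rev ≠ ⊤ ∧
    (sortedGap A μ πstar t.rev).toReal / (1 + L A) / U A ≤
      |phaseMean T (fun s i => X s i ω) (t + 1) e - μ e|} with hB
  have hsub : {ω | output O ruleX ruleP T (fun s i => X s i ω) ≠ some πstar} ⊆
      ⋃ t, ⋃ e, B t e := by
    intro ω hω
    by_contra hcon
    refine hω (output_eq_of_accurate hbest O ruleX ruleP hT _ fun t ht e => ?_)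
    by_contra hlt
    exact hcon (Set.mem_iUnion₂.2 ⟨t, e, ht, not_lt.1 hlt⟩)
  refine (measureReal_mono hsub).trans ((measureReal_iUnion_fintype_le _).trans ?_)
  have hterm : ∀ t e, P.real (B t e) ≤ 2 * Real.exp (-(9 / 4 * (((T : ℝ) - d) /
      (2 * (2 + L A ^ 2) ^ 2 * (R : ℝ) ^ 2 * (harmonic d : ℝ) * U A ^ 2 *
        (H2 A μ πstar).toReal)))) := by
    intro t e
    by_cases ht : sortedGap A μ πstar t.rev = ⊤
    · have : B t e = ∅ := by simp [hB, ht]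
      rw [this, measureReal_empty]
      positivity
    · have hε : 0 ≤ (sortedGap A μ πstar t.rev).toReal / (1 + L A) / U A :=
        div_nonneg (div_nonneg ENNReal.toReal_nonneg (by linarith)) (by linarith)
      have h := measureReal_le_abs_mean_sub_le (hindep e) (hX e) (phaseBudget_pos hT t) hε
      refine (measureReal_mono fun ω hω => hω.2).trans (h.trans ?_)
      refine mul_le_mul_of_nonneg_left (Real.exp_le_exp.2 (neg_le_neg ?_)) two_pos.le
      exact_mod_cast le_phaseBudget_mul hT hbest hL hU (NNReal.coe_pos.2 hR) t ht
  refine (Finset.sum_le_sum fun t _ => (measureReal_iUnion_fintype_le _).trans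
    (Finset.sum_le_sum fun e _ => hterm t e)).trans_eq ?_
  simp only [Finset.sum_const, Finset.card_univ, Fintype.card_fin, nsmul_eq_mul]
  ring

/-- With a single arm, only deviations to one side can cause an error. -/
theorem measureReal_output_ne_le_of_one {A : Finset (Fin 1 → ℝ)} {μ πstar : Fin 1 → ℝ}
    (hT : 1 < T) (hbest : IsBestAction A μ πstar) {π₀ : Fin 1 → ℝ} (hπ₀ : π₀ ∈ A)
    (hne : π₀ ≠ πstar) {R : ℝ≥0} (hR : 0 < R) {Ω : Type*} [MeasurableSpace Ω] {P : Measure Ω}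
    [IsProbabilityMeasure P] {X : Fin 1 → ℕ → Ω → ℝ}
    (hX : ∀ s i, HasSubgaussianMGF (fun ω => X s i ω - μ s) (R ^ 2) P)
    (hindep : ∀ s, iIndepFun (X s) P)
    (O : COracle A) (ruleX : ArgmaxRule ℝ) (ruleP : ArgmaxRule (Fin 1)) :
    P.real {ω | output O ruleX ruleP T (fun s i => X s i ω) ≠ some πstar} ≤
      Real.exp (-(9 / 4 * (((T : ℝ) - (1 : ℕ)) /
        (2 * (2 + L A ^ 2) ^ 2 * (R : ℝ) ^ 2 * (harmonic 1 : ℝ) * U A ^ 2 *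
          (H2 A μ πstar).toReal)))) := by
  have hval : ∀ π : Fin 1 → ℝ, π ≠ πstar → π 0 ≠ πstar 0 := fun π h h0 =>
    h (funext fun i => by rw [Subsingleton.elim i 0, h0])
  have hL : 1 ≤ L A := one_le_L hπ₀ hbest.1 (hval _ hne)
  have hU : 1 ≤ U A := one_le_U hπ₀ hbest.1 (hval _ hne)
  obtain ⟨j, -, hj⟩ := exists_sortedGap_le_gap A μ πstar ∅ Finset.card_empty one_pos
  have hj0 : j = 0 := Subsingleton.elim _ _
  subst hj0
  have hrev : (⟨1 - 1 - 0, by omega⟩ : Fin 1) = Fin.rev 0 := Subsingleton.elim _ _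
  rw [hrev] at hj
  obtain ⟨htop, hmul⟩ := mul_abs_sub_le_of_le_gap hbest hj hπ₀ (hval _ hne)
  set ε := (sortedGap A μ πstar (Fin.rev 0)).toReal / (1 + L A) / U A with hεdef
  have hΔ0 : 0 ≤ (sortedGap A μ πstar (Fin.rev 0)).toReal := ENNReal.toReal_nonneg
  have hε : 0 ≤ ε := div_nonneg (div_nonneg hΔ0 (by linarith)) (by linarith)
  have hεΔ : ε ≤ (sortedGap A μ πstar (Fin.rev 0)).toReal :=
    (div_le_self (div_nonneg hΔ0 (by linarith)) hU).trans (div_le_self hΔ0 (by linarith))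
  -- In dimension one every ratio defining the gap equals `|μ 0|`.
  have hεμ : ε ≤ |μ 0| := by
    refine hεΔ.trans (le_of_mul_le_mul_right ?_ (abs_pos.2 (sub_ne_zero.2 (hval _ hne).symm)))
    rw [← abs_mul]
    refine hmul.trans (le_trans (le_of_eq ?_) (le_abs_self _))
    simp [dotProduct]
  have hexp : Real.exp (-(phaseBudget 1 T 1 * ε ^ 2 / (2 * ((R ^ 2 : ℝ≥0) : ℝ)))) ≤
      Real.exp (-(9 / 4 * (((T : ℝ) - (1 : ℕ)) /
        (2 * (2 + L A ^ 2) ^ 2 * (R : ℝ) ^ 2 * (harmonic 1 : ℝ) * U A ^ 2 *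
          (H2 A μ πstar).toReal)))) := by
    refine Real.exp_le_exp.2 (neg_le_neg ?_)
    have h := le_phaseBudget_mul hT hbest hL hU (NNReal.coe_pos.2 hR) 0 htop
    simp only [Fin.val_zero, zero_add, ← hεdef] at h
    exact_mod_cast h
  -- After an error the empirical mean is zero or has the sign opposite to `μ 0`, so it deviates by
  -- at least `|μ 0|` in a direction known in advance.
  have herr : ∀ ω, output O ruleX ruleP T (fun s i => X s i ω) ≠ some πstar →
      ∃ v : ℝ, μ 0 * v < 0 ∧ 0 ≤ phaseMean T (fun s i => X s i ω) 1 0 * v := by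
    intro ω hω
    obtain ⟨π, hπ, hout, hmax⟩ := exists_output_eq_maximizer O ruleX ruleP hT ⟨πstar, hbest.1⟩
      fun s i => X s i ω
    have h1 := hbest.2 π hπ fun h => hω (h ▸ hout)
    have h2 := hmax πstar hbest.1
    simp only [dotProduct, Fin.sum_univ_one] at h1
    exact ⟨π 0 - πstar 0, by linarith, by linarith⟩
  have hn : 0 < phaseBudget 1 T 1 := phaseBudget_pos hT 0
  rcases le_total 0 (μ 0) with hμ | hμ
  · refine (measureReal_mono ?_).trans
      ((measureReal_le_sub_mean_le (hindep 0) (hX 0) hn hε).trans hexp)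
    intro ω hω
    obtain ⟨v, hv, hv'⟩ := herr ω hω
    have hv0 : v < 0 := by
      by_contra! h
      exact absurd hv (not_lt.2 (mul_nonneg hμ h))
    have hm : phaseMean T (fun s i => X s i ω) 1 0 ≤ 0 := by
      by_contra! h
      exact absurd hv' (not_le.2 (mul_neg_of_pos_of_neg h hv0))
    rw [abs_of_nonneg hμ] at hεμ
    change ε ≤ μ 0 - phaseMean T (fun s i => X s i ω) 1 0
    linarith
  · refine (measureReal_mono ?_).trans
      ((measureReal_le_mean_sub_le (hindep 0) (hX 0) hn hε).trans hexp)
    intro ω hω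
    obtain ⟨v, hv, hv'⟩ := herr ω hω
    have hv0 : 0 < v := by
      by_contra! h
      exact absurd hv (not_lt.2 (mul_nonneg_of_nonpos_of_nonpos hμ h))
    have hm : 0 ≤ phaseMean T (fun s i => X s i ω) 1 0 := by
      by_contra! h
      exact absurd hv' (not_le.2 (mul_neg_of_neg_of_pos h hv0))
    rw [abs_of_nonpos hμ] at hεμ
    change ε ≤ phaseMean T (fun s i => X s i ω) 1 0 - μ 0
    linarith

end CSA

/-! ### The main theorem -/

theorem theorem2 {d T : ℕ} (hT : d < T)
    (A : Finset (Fin d → ℝ))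
    (φ : Fin d → Measure ℝ) [∀ s, IsProbabilityMeasure (φ s)]
    (μ : Fin d → ℝ) (hμ : ∀ s, μ s = ∫ y, y ∂(φ s))
    (R : ℝ≥0) (hR : 0 < R)
    (hφ : ∀ s, HasSubgaussianMGF (fun y => y - μ s) (R ^ 2) (φ s))
    (πstar : Fin d → ℝ) (hbest : CSA.IsBestAction A μ πstar)
    {Ω : Type*} [MeasurableSpace Ω] (P : Measure Ω) [IsProbabilityMeasure P]
    (X : Fin d → ℕ → Ω → ℝ)
    (hlaw : ∀ s i, HasLaw (X s i) (φ s) P)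
    (hindep : ∀ s, iIndepFun (X s) P)
    (O : CSA.COracle A) (ruleX : CSA.ArgmaxRule ℝ) (ruleP : CSA.ArgmaxRule (Fin d)) :
    (∀ ω, CSA.samples O ruleX ruleP T (fun s i => X s i ω) ≤ T) ∧
    (∀ ω, CSA.output O ruleX ruleP T (fun s i => X s i ω) = none ∨
      ∃ π ∈ A, CSA.output O ruleX ruleP T (fun s i => X s i ω) = some π) ∧
    P.real {ω | CSA.output O ruleX ruleP T (fun s i => X s i ω) ≠ some πstar} ≤
      (d : ℝ) ^ 2 * Real.exp (-(((T : ℝ) - d) /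
        (2 * (2 + CSA.L A ^ 2) ^ 2 * (R : ℝ) ^ 2 * (harmonic d : ℝ) * CSA.U A ^ 2 *
          (CSA.H2 A μ πstar).toReal))) := by
  have hA : A.Nonempty := ⟨πstar, hbest.1⟩
  refine ⟨fun ω => CSA.samples_le O ruleX ruleP hT hA _, fun ω => Or.inr ?_, ?_⟩
  · obtain ⟨π, hπ, hout, -⟩ := CSA.exists_output_eq O ruleX ruleP hT hA fun s i => X s i ω
    exact ⟨π, hπ, hout⟩
  have hX : ∀ s i, HasSubgaussianMGF (fun ω => X s i ω - μ s) (R ^ 2) P := fun s i =>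
    HasSubgaussianMGF.of_map (X := fun y => y - μ s) (hlaw s i).aemeasurable
      ((hlaw s i).map_eq.symm ▸ hφ s)
  -- A second action gives L, U ≥ 1 and d > 0; otherwise, in particular for d = 0, the output is
  -- always `πstar`.
  by_cases hne : ∃ π ∈ A, π ≠ πstar
  · obtain ⟨π, hπ, hπne⟩ := hne
    obtain ⟨e, he⟩ := Function.ne_iff.1 hπne
    have hL := CSA.one_le_L hπ hbest.1 he
    have hU := CSA.one_le_U hπ hbest.1 he
    have hd : 0 < d := e.pos
    -- For d = 1 the claimed bound can be below 1 at small exponents, so a factor 2 could not be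
    -- absorbed there.
    rcases (Nat.succ_le_of_lt hd).eq_or_lt with h1 | h2
    · subst h1
      refine (CSA.measureReal_output_ne_le_of_one hT hbest hπ hπne hR hX hindep O ruleX
        ruleP).trans ?_
      rw [Nat.cast_succ, Nat.cast_zero, zero_add, one_pow, one_mul]
      refine Real.exp_le_exp.2 (neg_le_neg (le_mul_of_one_le_left ?_ (by norm_num)))
      have hTd : (1 : ℝ) < T := by exact_mod_cast hT
      have hH := CSA.harmonic_cast_pos (d := 1) one_pos
      refine div_nonneg (by linarith) ?_
      have := ENNReal.toReal_nonneg (a := CSA.H2 A μ πstar)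
      positivity
    · exact CSA.le_mul_exp_of_le_one (by exact_mod_cast h2) measureReal_le_one
        (CSA.measureReal_output_ne_le hT hbest hL hU hR hX hindep O ruleX ruleP)
  · push Not at hne
    have hempty : {ω | CSA.output O ruleX ruleP T (fun s i => X s i ω) ≠ some πstar} = ∅ := by
      refine Set.eq_empty_of_forall_notMem fun ω hω => hω ?_
      obtain ⟨π, hπ, hout, -⟩ := CSA.exists_output_eq O ruleX ruleP hT hA fun s i => X s i ω
      rw [hout, hne π hπ]
    rw [hempty, measureReal_empty]
    positivity
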